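/- Let $n\ge 0$ be an integer and let $S\subset\mathbb{R}^n$ be the union of a finite nonempty family of $n$-dimensional compact convex polyhedra. Here a convex polyhedron is a subset of $\mathbb{R}^n$ of the form $\{L_1\ge 0,\ldots,L_r\ge 0\}$ with $L_1,\ldots,L_r$ polynomials of degree at most $1$, and it is $n$-dimensional if its affine hull is $\mathbb{R}^n$. The following assertions are equivalent: (i) $S$ is connected by analytic paths, that is, for each pair of points $p_1,p_2\in S$ there exists an analytic path $\alpha:[0,1]\to S$ (the restriction to $[0,1]$ of a real analytic map from an open neighbourhood of $[0,1]$ to $\mathbb{R}^n$) such that $\alpha(0)=p_1$ and $\alpha(1)=p_2$. (ii) There exists a polynomial map $f:\mathbb{R}^{n+1}\to\mathbb{R}^n$ (a map whose components are real polynomials) such that $f(\overline{B}_{n+1})=S$, where $\overline{B}_{n+1}\subset\mathbb{R}^{n+1}$ is the closed unit ball centred at the origin. -/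

import Mathlib

/-- A map `f : ℝᵐ → ℝⁿ` is polynomial if each of its components is a polynomial function
of the coordinates. -/
def IsPolynomialMap {m n : ℕ}
    (f : EuclideanSpace ℝ (Fin m) → EuclideanSpace ℝ (Fin n)) : Prop :=
  ∃ p : Fin n → MvPolynomial (Fin m) ℝ,
    ∀ x i, f x i = MvPolynomial.eval (fun j => x j) (p i)

/-- `S ⊆ ℝⁿ` is connected by analytic paths: any two points of `S` are the endpoints of an
analytic path `[0,1] → S`. As usual, a path on the closed interval is analytic if it is (the
restriction of) a map which is analytic at every point of `[0,1]`, hence in an open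
neighbourhood of `[0,1]`. Only the values of `α` on `[0,1]` have to lie in `S`. -/
def ConnectedByAnalyticPaths {n : ℕ} (S : Set (EuclideanSpace ℝ (Fin n))) : Prop :=
  ∀ x ∈ S, ∀ y ∈ S, ∃ α : ℝ → EuclideanSpace ℝ (Fin n),
    AnalyticOnNhd ℝ α (Set.Icc 0 1) ∧ Set.MapsTo α (Set.Icc 0 1) S ∧ α 0 = x ∧ α 1 = y

/-- A convex polyhedron in `ℝⁿ`: the set of common solutions of finitely many inequalities
`L ≥ 0`, where `L` is a polynomial of degree at most one, i.e. an affine function. -/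
def IsConvexPolyhedron {n : ℕ} (K : Set (EuclideanSpace ℝ (Fin n))) : Prop :=
  ∃ (r : ℕ) (L : Fin r → (EuclideanSpace ℝ (Fin n) →ᵃ[ℝ] ℝ)), K = {x | ∀ j, 0 ≤ L j x}

/-- An `n`-dimensional compact convex polyhedron in `ℝⁿ`. The dimension is that of the affine
hull, so being `n`-dimensional means that the affine hull is all of `ℝⁿ` (in particular the
polyhedron is nonempty, also for `n = 0`). -/
structure IsFullDimCompactConvexPolyhedron {n : ℕ}
    (K : Set (EuclideanSpace ℝ (Fin n))) : Prop where
  isConvexPolyhedron : IsConvexPolyhedron K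
  isCompact : IsCompact K
  affineSpan_eq_top : affineSpan ℝ K = ⊤

open Set Filter Topology Polynomial

namespace PolynomialBallImage

/-! ### Convex polyhedra -/

section Polyhedron

variable {n : ℕ}

local notation "E" => EuclideanSpace ℝ (Fin n)

/-! From (ii) to (i), compose `f` with segments of the ball. For the converse, Carathéodory covers
each polyhedron by finitely many simplices. It suffices to find `n + 1` polynomial paths on `[0, M]`
that at each time lie in a common `K i`, and that at suitable times are the vertices of each
covering simplex. By convexity the moving simplex then sweeps out exactly `S`, and the ball maps
polynomially onto [time interval] × [standard simplex] (`exists_isPolynomialMap_image_eq`).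

To find the paths, join interior points of two polyhedra by an analytic path starting off all
bounding hyperplanes. No nontrivial constraint vanishes identically along it, so each passage
between polyhedra survives perturbations of high order and can be replaced by a Taylor polynomial
(`exists_isCrossingOfOrder`). Hence any two polyhedra are joined by a chain of polynomial crossings
(`eqvGen_linked`). Along such a chain, Hermite interpolation fixes the jets at the crossing times,
and a correction vanishing there to high order keeps the path in the right convex set elsewhere
(`exists_polyPath_chain`). -/

theorem isClosed_nonneg_affine (L : E →ᵃ[ℝ] ℝ) : IsClosed {x | 0 ≤ L x} :=
  isClosed_le continuous_const L.continuous_of_finiteDimensional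

theorem convex_setOf_forall_nonneg {r : ℕ} (L : Fin r → (E →ᵃ[ℝ] ℝ)) :
    Convex ℝ {x | ∀ j, 0 ≤ L j x} := by
  rw [ofPred_forall]
  exact convex_iInter fun j => (convex_Ici (0 : ℝ)).affine_preimage (L j)

theorem isClosed_setOf_forall_nonneg {r : ℕ} (L : Fin r → (E →ᵃ[ℝ] ℝ)) :
    IsClosed {x | ∀ j, 0 ≤ L j x} := by
  rw [ofPred_forall]
  exact isClosed_iInter fun j => isClosed_nonneg_affine (L j)

/-- An extreme point of a polyhedron is determined by the constraints that are active at it. -/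
theorem finite_extremePoints {r : ℕ} (L : Fin r → (E →ᵃ[ℝ] ℝ)) :
    (extremePoints ℝ {x | ∀ j, 0 ≤ L j x}).Finite := by
  classical
  refine Set.Finite.of_finite_image (f := fun x : E => {j | L j x = 0}) (Set.toFinite _) ?_
  intro x hx y hy hxy
  by_contra hne
  rw [mem_extremePoints] at hx
  obtain ⟨hxK, hx⟩ := hx
  have hyK : ∀ j, 0 ≤ L j y := hy.1
  -- Constraints active at `x` vanish at `y` too, hence on the whole line; the others stay positive
  -- near `x`. So `x` is a midpoint inside the polyhedron.
  have key : ∀ᶠ s : ℝ in 𝓝 0, ∀ j, 0 ≤ L j (AffineMap.lineMap x y s) := by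
    rw [eventually_all]
    intro j
    have hline (s : ℝ) : L j (AffineMap.lineMap x y s) = L j x + s * (L j y - L j x) := by
      rw [AffineMap.apply_lineMap, AffineMap.lineMap_apply]
      simp [add_comm]
    simp only [hline]
    rcases (hxK j).eq_or_lt with h0 | h0
    · have hy0 : L j y = 0 := (Set.ext_iff.1 hxy j).1 h0.symm
      simp [← h0, hy0]
    · have hc : Continuous fun s : ℝ => L j x + s * (L j y - L j x) := by fun_prop
      have := hc.tendsto 0
      simp only [zero_mul, add_zero] at this
      exact (this.eventually (lt_mem_nhds h0)).mono fun _ h => h.le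
  obtain ⟨ε, hε, hball⟩ := Metric.eventually_nhds_iff.1 key
  have h1 := hball (y := ε / 2) (by simp [abs_of_pos hε, hε])
  have h2 := hball (y := -(ε / 2)) (by simp [abs_of_pos hε, hε])
  have hmem : x ∈ openSegment ℝ (AffineMap.lineMap x y (ε / 2)) (AffineMap.lineMap x y (-(ε / 2)))
      := by
    refine ⟨1 / 2, 1 / 2, by norm_num, by norm_num, by norm_num, ?_⟩
    simp only [AffineMap.lineMap_apply, vsub_eq_sub, vadd_eq_add]
    module
  have := (hx _ h1 _ h2 hmem)
  have h3 : (ε / 2) • (y - x) = 0 := by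
    simpa [AffineMap.lineMap_apply] using this
  rcases smul_eq_zero.1 h3 with h | h
  · linarith
  · exact hne (sub_eq_zero.1 h).symm

/-- Krein–Milman; no closure is needed because the hull of a finite set is compact. -/
theorem exists_finite_convexHull_eq {K : Set E} (hK : IsConvexPolyhedron K) (hc : IsCompact K) :
    ∃ V : Set E, V.Finite ∧ convexHull ℝ V = K := by
  obtain ⟨r, L, rfl⟩ := hK
  have hfin := finite_extremePoints L
  refine ⟨_, hfin, ?_⟩
  have := closure_convexHull_extremePoints hc (convex_setOf_forall_nonneg L)
  rwa [(hfin.isCompact_convexHull ℝ).isClosed.closure_eq] at this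

/-- A polytope in `ℝⁿ` is covered by finitely many simplices, possibly degenerate, with `n + 1`
vertices. -/
theorem exists_finite_simplices {K : Set E} (hK : IsConvexPolyhedron K) (hc : IsCompact K) :
    ∃ T : Set (Fin (n + 1) → E), T.Finite ∧ (∀ v ∈ T, ∀ j, v j ∈ K) ∧
      ∀ x ∈ K, ∃ v ∈ T, ∃ w : Fin (n + 1) → ℝ, (∀ j, 0 ≤ w j) ∧ ∑ j, w j = 1 ∧
        ∑ j, w j • v j = x := by
  obtain ⟨V, hV, rfl⟩ := exists_finite_convexHull_eq hK hc
  refine ⟨Set.pi univ fun _ => V, Set.Finite.pi fun _ => hV,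
    fun v hv j => subset_convexHull ℝ V (hv j (mem_univ j)), fun x hx => ?_⟩
  obtain ⟨κ, _, z, w, hz, haff, hw0, hw1, hsum⟩ := eq_pos_convex_span_of_mem_convexHull hx
  have hne : Nonempty κ := by
    by_contra h
    rw [not_nonempty_iff] at h
    simp at hw1
  have hcard : Fintype.card κ ≤ Fintype.card (Fin (n + 1)) := by
    refine haff.card_le_finrank_succ.trans ?_
    have := Submodule.finrank_le (vectorSpan ℝ (range z))
    simp only [finrank_euclideanSpace, Fintype.card_fin] at this ⊢
    omega
  -- Vertices are repeated to have exactly `n + 1` of them.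
  obtain ⟨e⟩ := Function.Embedding.nonempty_of_card_le hcard
  have hsurj := Function.invFun_surjective e.injective
  set d := Function.invFun e
  refine ⟨z ∘ d, fun j _ => hz ⟨_, rfl⟩, ?_⟩
  have hx' : x ∈ convexHull ℝ (range (z ∘ d)) := by
    rw [hsurj.range_comp, ← hsum]
    exact (convex_convexHull ℝ _).sum_mem (fun i _ => (hw0 i).le) hw1
      fun i _ => subset_convexHull ℝ _ ⟨i, rfl⟩
  rw [convexHull_range_eq_exists_affineCombination] at hx'
  obtain ⟨s, w', hw0', hw1', hsum'⟩ := hx'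
  rw [s.affineCombination_eq_linear_combination _ _ hw1'] at hsum'
  refine ⟨fun j => if j ∈ s then w' j else 0, fun j => ?_, ?_, ?_⟩
  · dsimp only; split_ifs with h
    exacts [hw0' j h, le_rfl]
  · simpa using hw1'
  · simpa using hsum'

/-- Away from finitely many proper affine hyperplanes one can choose points in any nonempty open
set. -/
theorem exists_mem_forall_ne_zero {κ : Type*} [Finite κ] (L : κ → (E →ᵃ[ℝ] ℝ)) {U : Set E}
    (hU : IsOpen U) (hne : U.Nonempty) : ∃ p ∈ U, ∀ j, L j ≠ 0 → L j p ≠ 0 := by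
  have hopen (j : {j // L j ≠ 0}) : IsOpen {x | L j x ≠ 0} :=
    isOpen_ne_fun (L j).continuous_of_finiteDimensional continuous_const
  have hdense (j : {j // L j ≠ 0}) : Dense {x | L j x ≠ 0} := by
    obtain ⟨y, hy⟩ : ∃ y, L j y ≠ 0 := by
      by_contra! h
      exact j.2 (AffineMap.ext h)
    intro x
    by_cases hx : L j x = 0
    swap
    · exact subset_closure hx
    have hc : Continuous fun s : ℝ => AffineMap.lineMap (k := ℝ) x y s := AffineMap.lineMap_continuous
    have ht : Tendsto (fun s : ℝ => AffineMap.lineMap (k := ℝ) x y s) (𝓝[≠] 0) (𝓝 x) :=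
      ((hc.tendsto 0).mono_left nhdsWithin_le_nhds).trans (by simp)
    refine mem_closure_of_tendsto ht ?_
    filter_upwards [self_mem_nhdsWithin] with s hs
    rw [AffineMap.apply_lineMap, hx, AffineMap.lineMap_apply]
    simpa [hy] using hs
  have := dense_iInter_of_isOpen hopen hdense
  obtain ⟨p, hp, hpU⟩ := this.exists_mem_open hU hne
  exact ⟨p, hpU, fun j hj => mem_iInter.1 hp ⟨j, hj⟩⟩

end Polyhedron

/-! ### Polynomial paths and crossings -/

section Crossing

variable {n : ℕ}

local notation "E" => EuclideanSpace ℝ (Fin n)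

/-- The path in `ℝⁿ` whose components are the given polynomials. -/
noncomputable def polyPath (g : Fin n → ℝ[X]) (t : ℝ) : E :=
  WithLp.toLp 2 fun i => (g i).eval t

@[simp] theorem polyPath_apply (g : Fin n → ℝ[X]) (t : ℝ) (i : Fin n) :
    polyPath g t i = (g i).eval t := rfl

theorem continuous_polyPath (g : Fin n → ℝ[X]) : Continuous (polyPath g) :=
  (PiLp.continuous_toLp 2 _).comp (continuous_pi fun i => (g i).continuous)

/-- The polynomial path `g` goes from `A` to `B` at time `0`, with a margin of order `N`. -/
def IsCrossingOfOrder (g : Fin n → ℝ[X]) (A B : Set E) (N : ℕ) : Prop :=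
  ∃ c > 0, ∀ᶠ s : ℝ in 𝓝 0, ∀ e : E, ‖e‖ ≤ c →
    (s ≤ 0 → polyPath g s + s ^ N • e ∈ A) ∧ (0 ≤ s → polyPath g s + s ^ N • e ∈ B)

theorem IsCrossingOfOrder.mono {g : Fin n → ℝ[X]} {A B : Set E} {N N' : ℕ}
    (h : IsCrossingOfOrder g A B N) (hN : N ≤ N') : IsCrossingOfOrder g A B N' := by
  obtain ⟨c, hc, h⟩ := h
  refine ⟨c, hc, ?_⟩
  have h1 : ∀ᶠ s : ℝ in 𝓝 0, |s| ≤ 1 := by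
    filter_upwards [Metric.ball_mem_nhds (0 : ℝ) one_pos] with s hs
    simpa using (mem_ball_zero_iff.1 hs).le
  filter_upwards [h, h1] with s hs hs1 e he
  have he' : ‖s ^ (N' - N) • e‖ ≤ c := by
    rw [norm_smul, norm_pow, Real.norm_eq_abs]
    exact (mul_le_of_le_one_left (norm_nonneg e) (pow_le_one₀ (abs_nonneg s) hs1)).trans he
  have := hs _ he'
  rwa [smul_smul, ← pow_add, Nat.add_sub_cancel' hN] at this

theorem polyPath_comp_neg (g : Fin n → ℝ[X]) (t : ℝ) :
    polyPath (fun i => (g i).comp (-X)) t = polyPath g (-t) := by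
  ext i
  simp

theorem IsCrossingOfOrder.symm {g : Fin n → ℝ[X]} {A B : Set E} {N : ℕ}
    (h : IsCrossingOfOrder g A B N) :
    IsCrossingOfOrder (fun i => (g i).comp (-X)) B A N := by
  obtain ⟨c, hc, h⟩ := h
  refine ⟨c, hc, ?_⟩
  have ht : Tendsto (fun s : ℝ => -s) (𝓝 0) (𝓝 0) := by simpa using (continuous_neg (G := ℝ)).tendsto 0
  filter_upwards [ht.eventually h] with s hs e he
  rw [polyPath_comp_neg]
  -- The ball of perturbations is symmetric, so it absorbs the sign of `(-s) ^ N`.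
  have h1 : ‖((-1 : ℝ) ^ N) • e‖ ≤ c := by
    rw [norm_smul]; simpa using he
  have := hs _ h1
  rw [smul_smul, ← mul_pow] at this
  simp only [mul_neg, mul_one, neg_neg] at this
  exact ⟨fun h => this.2 (by linarith), fun h => this.1 (by linarith)⟩

/-- A convex body has a polynomial path that touches a prescribed point. -/
theorem exists_isCrossingOfOrder_self {A : Set E} (hA : Convex ℝ A) (hint : (interior A).Nonempty)
    {v : E} (hv : v ∈ A) :
    ∃ g : Fin n → ℝ[X], polyPath g 0 = v ∧ IsCrossingOfOrder g A A 2 := by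
  obtain ⟨a, ha⟩ := hint
  obtain ⟨c, hc, hball⟩ := Metric.nhds_basis_closedBall.mem_iff.1 (mem_interior_iff_mem_nhds.1 ha)
  -- Perturbed by `s ^ 2 • e`, this path is the convex combination `(1 - s ^ 2) v + s ^ 2 (a + e)`,
  -- for either sign of `s`.
  refine ⟨fun i => C (v i) + X ^ 2 * C (a i - v i), by ext i; simp, c, hc, ?_⟩
  have h1 : ∀ᶠ s : ℝ in 𝓝 0, s ^ 2 ≤ 1 := by
    have : Tendsto (fun s : ℝ => s ^ 2) (𝓝 0) (𝓝 (0 ^ 2)) := (continuous_pow 2).tendsto 0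
    exact (this.eventually (gt_mem_nhds (by norm_num : (0 : ℝ) ^ 2 < 1))).mono fun _ h => h.le
  filter_upwards [h1] with s hs e he
  have : polyPath (fun i => C (v i) + X ^ 2 * C (a i - v i)) s + s ^ 2 • e ∈ A := by
    have hmem : a + e ∈ A := hball (by simpa using he)
    have := hA hv hmem (by linarith : 0 ≤ 1 - s ^ 2) (sq_nonneg s) (by ring)
    convert this using 1
    ext i
    simp
    ring
  exact ⟨fun _ => this, fun _ => this⟩

theorem exists_polynomial_isBigO {f : ℝ → ℝ} {t₀ : ℝ} (hf : AnalyticAt ℝ f t₀) (N : ℕ) :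
    ∃ q : ℝ[X], (fun s => q.eval s - f (t₀ + s)) =O[𝓝 0] fun s => s ^ N := by
  obtain ⟨p, hp⟩ := hf
  refine ⟨∑ k ∈ Finset.range N, C (p.coeff k) * X ^ k, ?_⟩
  have := (hp.isBigO_sub_partialSum_pow N).neg_left
  refine (this.congr (fun s => ?_) fun s => rfl).trans (Asymptotics.isBigO_of_le _ fun s => by simp)
  simp only [FormalMultilinearSeries.partialSum, FormalMultilinearSeries.apply_eq_pow_smul_coeff,
    eval_finsetSum, eval_mul, eval_C, eval_pow, eval_X, smul_eq_mul, neg_sub, mul_comm]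

theorem exists_polyPath_isBigO {β : ℝ → E} {t₀ : ℝ} (hβ : AnalyticAt ℝ β t₀) (N : ℕ) :
    ∃ g : Fin n → ℝ[X], (fun s => polyPath g s - β (t₀ + s)) =O[𝓝 0] fun s => s ^ N := by
  have hcomp (i : Fin n) : AnalyticAt ℝ (fun t => β t i) t₀ :=
    ((EuclideanSpace.proj (𝕜 := ℝ) i : E →L[ℝ] ℝ).analyticAt _).comp hβ
  choose g hg using fun i => exists_polynomial_isBigO (hcomp i) N
  refine ⟨g, ?_⟩
  have hpi : (fun s i => (g i).eval s - β (t₀ + s) i) =O[𝓝 0] fun s => s ^ N :=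
    Asymptotics.isBigO_pi.2 hg
  exact ((EuclideanSpace.equiv (Fin n) ℝ).symm.toContinuousLinearMap.isBigO_comp
    (fun s i => (g i).eval s - β (t₀ + s) i) (𝓝 0)).trans hpi

theorem exists_affine_sub_le (L : E →ᵃ[ℝ] ℝ) :
    ∃ ℓ : ℝ, 0 ≤ ℓ ∧ ∀ x y, |L x - L y| ≤ ℓ * ‖x - y‖ := by
  refine ⟨‖L.linear.toContinuousLinearMap‖, norm_nonneg _, fun x y => ?_⟩
  have := L.linear.toContinuousLinearMap.le_opNorm (x - y)
  rwa [LinearMap.coe_toContinuousLinearMap', ← vsub_eq_sub x y, L.linearMap_vsub] at this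

theorem analyticAt_affine_comp (L : E →ᵃ[ℝ] ℝ) {β : ℝ → E} {t₀ : ℝ} (hβ : AnalyticAt ℝ β t₀) :
    AnalyticAt ℝ (fun t => L (β t)) t₀ := by
  have : (fun t => L (β t)) = fun t => L.linear.toContinuousLinearMap (β t) + L 0 := by
    ext t
    rw [LinearMap.coe_toContinuousLinearMap']
    exact congrFun (AffineMap.decomp L) (β t)
  rw [this]
  exact ((L.linear.toContinuousLinearMap.analyticAt _).comp hβ).add analyticAt_const

/-- If an affine function does not vanish identically along an analytic path, then its sign is not
affected by perturbations of the path of high order. -/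
theorem exists_order_nonneg {β : ℝ → E} {t₀ : ℝ} (hβ : AnalyticAt ℝ β t₀) (L : E →ᵃ[ℝ] ℝ)
    (hL : L ≠ 0 → ¬ ∀ᶠ t in 𝓝 t₀, L (β t) = 0) :
    ∃ N₀ : ℕ, ∀ N ≥ N₀, ∀ p : ℝ → E, (fun s => p s - β (t₀ + s)) =O[𝓝 0] (fun s => s ^ N) →
      ∀ᶠ s : ℝ in 𝓝 0, 0 ≤ L (β (t₀ + s)) → ∀ e : E, ‖e‖ ≤ 1 → 0 ≤ L (p s + s ^ N • e) := by
  by_cases h0 : L = 0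
  · exact ⟨0, fun N _ p _ => by simp [h0]⟩
  obtain ⟨k, u, hu, hu0, hLu⟩ :=
    (analyticAt_affine_comp L hβ).exists_eventuallyEq_pow_smul_nonzero_iff.2 (hL h0)
  obtain ⟨ℓ, hℓ, hlip⟩ := exists_affine_sub_le L
  -- `L ∘ β` has exact order `k` at `t₀`, while the perturbation changes `L` by `O(s ^ N)`, which is
  -- negligible for `N > k`.
  refine ⟨k + 1, fun N hN p hp => ?_⟩
  obtain ⟨D, hD, hp⟩ := hp.exists_pos
  have ht : Tendsto (fun s : ℝ => t₀ + s) (𝓝 0) (𝓝 t₀) :=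
    Continuous.tendsto' (by fun_prop) _ _ (add_zero t₀)
  have hu' : ∀ᶠ s : ℝ in 𝓝 0, |u t₀| / 2 < |u (t₀ + s)| :=
    ht.eventually (hu.continuousAt.abs.eventually (lt_mem_nhds (half_lt_self (abs_pos.2 hu0))))
  have hs : ∀ᶠ s : ℝ in 𝓝 0, ℓ * (D + 1) * |s| < |u t₀| / 2 := by
    have hc : Continuous fun s : ℝ => ℓ * (D + 1) * |s| := by fun_prop
    have := hc.tendsto 0
    rw [abs_zero, mul_zero] at this
    exact this.eventually (gt_mem_nhds (half_pos (abs_pos.2 hu0)))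
  have hs1 : ∀ᶠ s : ℝ in 𝓝 0, |s| ≤ 1 := by
    filter_upwards [Metric.ball_mem_nhds (0 : ℝ) one_pos] with s hs
    simpa using (mem_ball_zero_iff.1 hs).le
  filter_upwards [hp.bound, hu', hs, hs1, ht.eventually hLu] with s hps hus hs hs1 hLs hnn e he
  have hval : L (β (t₀ + s)) = |s| ^ k * |u (t₀ + s)| := by
    rw [← abs_of_nonneg hnn, hLs]
    simp [abs_mul]
  have hpow : |s| ^ N ≤ |s| ^ k * |s| := by
    rw [← pow_succ]
    exact pow_le_pow_of_le_one (abs_nonneg s) hs1 hN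
  have hdist : ‖p s + s ^ N • e - β (t₀ + s)‖ ≤ (D + 1) * |s| ^ N := by
    calc ‖p s + s ^ N • e - β (t₀ + s)‖ = ‖(p s - β (t₀ + s)) + s ^ N • e‖ := by congr 1; abel
      _ ≤ ‖p s - β (t₀ + s)‖ + ‖s ^ N • e‖ := norm_add_le _ _
      _ ≤ D * |s| ^ N + |s| ^ N * 1 := by
        refine add_le_add (by simpa using hps) ?_
        rw [norm_smul, norm_pow, Real.norm_eq_abs]
        gcongr
      _ = _ := by ring
  have h1 := (abs_le.1 (hlip (p s + s ^ N • e) (β (t₀ + s)))).1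
  have h2 : ℓ * ‖p s + s ^ N • e - β (t₀ + s)‖ ≤ |s| ^ k * (|u t₀| / 2) := by
    calc ℓ * ‖p s + s ^ N • e - β (t₀ + s)‖ ≤ ℓ * ((D + 1) * (|s| ^ k * |s|)) := by gcongr; exact hdist.trans (by gcongr)
      _ = |s| ^ k * (ℓ * (D + 1) * |s|) := by ring
      _ ≤ _ := by gcongr
  have h3 : |s| ^ k * (|u t₀| / 2) ≤ |s| ^ k * |u (t₀ + s)| := by gcongr
  linarith

/-- An analytic path which goes from one polyhedron to another one, and is not locally contained
in the boundary hyperplanes, can be replaced by a polynomial one. -/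
theorem exists_isCrossingOfOrder {β : ℝ → E} {t₀ : ℝ} (hβ : AnalyticAt ℝ β t₀)
    {r r' : ℕ} (L : Fin r → (E →ᵃ[ℝ] ℝ)) (L' : Fin r' → (E →ᵃ[ℝ] ℝ))
    (hL : ∀ j, L j ≠ 0 → ¬ ∀ᶠ t in 𝓝 t₀, L j (β t) = 0)
    (hL' : ∀ j, L' j ≠ 0 → ¬ ∀ᶠ t in 𝓝 t₀, L' j (β t) = 0)
    (hA : ∀ᶠ t in 𝓝[<] t₀, β t ∈ {x | ∀ j, 0 ≤ L j x})
    (hB : ∀ᶠ t in 𝓝[>] t₀, β t ∈ {x | ∀ j, 0 ≤ L' j x}) :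
    ∃ g : Fin n → ℝ[X], ∃ N,
      IsCrossingOfOrder g {x | ∀ j, 0 ≤ L j x} {x | ∀ j, 0 ≤ L' j x} N := by
  choose N₁ hN₁ using fun j => exists_order_nonneg hβ (L j) (hL j)
  choose N₂ hN₂ using fun j => exists_order_nonneg hβ (L' j) (hL' j)
  set N := ∑ j, N₁ j + ∑ j, N₂ j
  have hNle₁ (j) : N₁ j ≤ N :=
    (Finset.single_le_sum (f := N₁) (fun _ _ => Nat.zero_le _) (Finset.mem_univ j)).trans (by omega)
  have hNle₂ (j) : N₂ j ≤ N :=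
    (Finset.single_le_sum (f := N₂) (fun _ _ => Nat.zero_le _) (Finset.mem_univ j)).trans (by omega)
  obtain ⟨g, hg⟩ := exists_polyPath_isBigO hβ N
  refine ⟨g, N, 1, one_pos, ?_⟩
  have ht : Tendsto (fun s : ℝ => t₀ + s) (𝓝 0) (𝓝 t₀) :=
    Continuous.tendsto' (by fun_prop) _ _ (add_zero t₀)
  have hA₀ : β t₀ ∈ {x | ∀ j, 0 ≤ L j x} :=
    (isClosed_setOf_forall_nonneg L).mem_of_tendsto
      (hβ.continuousAt.tendsto.mono_left nhdsWithin_le_nhds) hA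
  have hB₀ : β t₀ ∈ {x | ∀ j, 0 ≤ L' j x} :=
    (isClosed_setOf_forall_nonneg L').mem_of_tendsto
      (hβ.continuousAt.tendsto.mono_left nhdsWithin_le_nhds) hB
  filter_upwards [eventually_all.2 fun j => hN₁ j N (hNle₁ j) _ hg,
    eventually_all.2 fun j => hN₂ j N (hNle₂ j) _ hg,
    ht.eventually (eventually_nhdsWithin_iff.1 hA),
    ht.eventually (eventually_nhdsWithin_iff.1 hB)] with s h1 h2 h3 h4 e he
  refine ⟨fun hs j => h1 j ?_ e he, fun hs j => h2 j ?_ e he⟩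
  · rcases hs.eq_or_lt with rfl | hs
    · simpa using hA₀ j
    · exact h3 (by simpa using hs) j
  · rcases hs.eq_or_lt with rfl | hs
    · simpa using hB₀ j
    · exact h4 (by simpa using hs) j

end Crossing

/-! ### Polynomial paths through a chain of convex sets -/

section Selection

variable {n : ℕ}

local notation "E" => EuclideanSpace ℝ (Fin n)

theorem exists_polyPath_near (φ : ℝ → E) (hφ : Continuous φ) (a b : ℝ) {ε : ℝ} (hε : 0 < ε) :
    ∃ g : Fin n → ℝ[X], ∀ t ∈ Icc a b, ‖polyPath g t - φ t‖ ≤ ε := by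
  have hc : Continuous fun x : Fin n → ℝ => (WithLp.toLp 2 x : E) := PiLp.continuous_toLp 2 _
  obtain ⟨δ, hδ, hball⟩ := Metric.continuousAt_iff.1 (hc.continuousAt (x := 0)) ε hε
  have hcomp (i : Fin n) : Continuous fun t => φ t i :=
    (EuclideanSpace.proj (𝕜 := ℝ) i : E →L[ℝ] ℝ).continuous.comp hφ
  choose g hg using fun i => exists_polynomial_near_of_continuousOn a b (fun t => φ t i)
    (hcomp i).continuousOn δ hδ
  refine ⟨g, fun t ht => ?_⟩
  have := hball (x := fun i => (g i).eval t - φ t i) (by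
    rw [dist_pi_lt_iff hδ]
    intro i
    simpa using hg i t ht)
  rw [dist_eq_norm, WithLp.toLp_zero, sub_zero] at this
  exact this.le

/-- Weighted polynomial selection: if `H + w y` can be kept, locally and with a margin, in the
convex sets `A t`, then there is a polynomial choice of `y`. -/
theorem exists_polyPath_forall_mem {A : ℝ → Set E} (hA : ∀ t, Convex ℝ (A t)) (a b : ℝ)
    (H : ℝ → E) (w : ℝ → ℝ)
    (hloc : ∀ t₀ ∈ Icc a b, ∃ y : E, ∀ᶠ q : ℝ × E in 𝓝 (t₀, 0), q.1 ∈ Icc a b →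
      H q.1 + w q.1 • (y + q.2) ∈ A q.1) :
    ∃ g : Fin n → ℝ[X], ∀ t ∈ Icc a b, H t + w t • polyPath g t ∈ A t := by
  -- Compactness makes the margin uniform. The admissible `y` with margin `ε` form convex sets, so a
  -- continuous selection exists, and Weierstrass approximation within `ε` stays admissible.
  obtain ⟨ε, hε, hεloc⟩ : ∃ ε > 0, ∀ t₀ ∈ Icc a b, ∃ y : E, ∀ᶠ t in 𝓝 t₀, t ∈ Icc a b →
      ∀ e : E, ‖e‖ ≤ ε → H t + w t • (y + e) ∈ A t := by
    refine isCompact_Icc.induction_on (s := Icc a b) (p := fun s => ∃ ε > 0, ∀ t₀ ∈ s, ∃ y : E,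
      ∀ᶠ t in 𝓝 t₀, t ∈ Icc a b → ∀ e : E, ‖e‖ ≤ ε → H t + w t • (y + e) ∈ A t)
      ⟨1, one_pos, by simp⟩ ?_ ?_ ?_
    · rintro s s' hss' ⟨ε, hε, h⟩
      exact ⟨ε, hε, fun t ht => h t (hss' ht)⟩
    · rintro s s' ⟨ε, hε, h⟩ ⟨ε', hε', h'⟩
      refine ⟨min ε ε', lt_min hε hε', fun t ht => ?_⟩
      rcases ht with ht | ht
      · obtain ⟨y, hy⟩ := h t ht
        exact ⟨y, hy.mono fun t h hI e he => h hI e (he.trans (min_le_left _ _))⟩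
      · obtain ⟨y, hy⟩ := h' t ht
        exact ⟨y, hy.mono fun t h hI e he => h hI e (he.trans (min_le_right _ _))⟩
    · intro t₀ ht₀
      obtain ⟨y, hy⟩ := hloc t₀ ht₀
      rw [nhds_prod_eq] at hy
      obtain ⟨p, hp, q, hq, hpq⟩ := eventually_prod_iff.1 hy
      obtain ⟨ε, hε, hball⟩ := Metric.nhds_basis_closedBall.eventually_iff.1 hq
      refine ⟨{t | ∀ᶠ s in 𝓝 t, p s}, mem_nhdsWithin_of_mem_nhds
        (eventually_eventually_nhds.2 hp), ε, hε, fun t ht => ⟨y, ?_⟩⟩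
      filter_upwards [ht] with s hs hI e he
      exact hpq hs (hball (by simpa using he)) hI
  obtain ⟨φ, hφ⟩ := exists_continuous_forall_mem_convex_of_local_const (X := ℝ)
    (t := fun t => {y | t ∈ Icc a b → ∀ e : E, ‖e‖ ≤ ε → H t + w t • (y + e) ∈ A t}) (by
      intro t y hy y' hy' α γ hα hγ hαγ hI e he
      have := hA t (hy hI e he) (hy' hI e he) hα hγ hαγ
      convert this using 1
      obtain rfl : γ = 1 - α := by linarith
      module) (by
      intro t
      by_cases ht : t ∈ Icc a b
      · exact hεloc t ht
      · refine ⟨0, ?_⟩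
        filter_upwards [isClosed_Icc.isOpen_compl.mem_nhds ht] with s hs hI
        exact absurd hI hs)
  obtain ⟨g, hg⟩ := exists_polyPath_near φ φ.continuous a b hε
  refine ⟨g, fun t ht => ?_⟩
  have := hφ t ht _ (hg t ht)
  rwa [add_sub_cancel] at this

/-- Chinese remainder theorem for the pairwise coprime ideals generated by `(X - k) ^ N`. -/
theorem exists_hermite (M N : ℕ) (g : ℕ → ℝ[X]) :
    ∃ H : ℝ[X], ∀ k < M, ∃ r : ℝ[X], H = (g k).comp (X - C (k : ℝ)) + (X - C (k : ℝ)) ^ N * r := by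
  obtain ⟨H, hH⟩ := Ideal.exists_forall_sub_mem_ideal
    (I := fun k : Fin M => Ideal.span {(X - C ((k : ℕ) : ℝ)) ^ N})
    (by
      intro k l hkl
      refine (Ideal.isCoprime_span_singleton_iff _ _).2 (IsCoprime.pow ?_)
      refine isCoprime_X_sub_C_of_isUnit_sub (IsUnit.mk0 _ (sub_ne_zero.2 ?_))
      exact fun h => hkl (Fin.ext (Nat.cast_injective h)))
    fun k => (g k).comp (X - C ((k : ℕ) : ℝ))
  refine ⟨H, fun k hk => ?_⟩
  obtain ⟨r, hr⟩ := Ideal.mem_span_singleton'.1 (hH ⟨k, hk⟩)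
  exact ⟨r, by rw [mul_comm, hr]; ring⟩

/-- Given a chain of convex sets with nonempty interiors and crossings between consecutive ones,
there is a polynomial path along the chain with prescribed values at the crossing times. -/
theorem exists_polyPath_chain (A : ℕ → Set E) (hA : ∀ k, Convex ℝ (A k))
    (hint : ∀ k, (interior (A k)).Nonempty) (M : ℕ) (g : ℕ → Fin n → ℝ[X]) (ord : ℕ → ℕ)
    (hg : ∀ k < M, IsCrossingOfOrder (g k) (A k) (A (k + 1)) (ord k)) :
    ∃ P : Fin n → ℝ[X], (∀ t ∈ Icc (0 : ℝ) M, polyPath P t ∈ A ⌈t⌉₊) ∧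
      ∀ k < M, polyPath P k = polyPath (g k) 0 := by
  classical
  -- The `+ 1` makes `w` vanish at the crossing times, so the correction preserves the prescribed
  -- values.
  set N := (∑ k ∈ Finset.range M, ord k) + 1
  have hg' (k) (hk : k < M) : IsCrossingOfOrder (g k) (A k) (A (k + 1)) N :=
    (hg k hk).mono ((Finset.single_le_sum (f := ord) (fun _ _ => Nat.zero_le _)
      (Finset.mem_range.2 hk)).trans (Nat.le_succ _))
  -- Matching to order `N + 1` leaves a spare factor `t - k`, which makes the error smaller than the
  -- margin `c * |t - k| ^ N` near `k`.
  choose H hH using fun i => exists_hermite M (N + 1) fun k => g k i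
  choose! r hr using hH
  have hHk (k) (hk : k < M) (t : ℝ) : polyPath H t = polyPath (g k) (t - k) +
      (t - k) ^ (N + 1) • polyPath (fun i => r i k) t := by
    ext i
    have := congrArg (eval t) (hr i k hk)
    simpa using this
  set w : ℝ[X] := ∏ k ∈ Finset.range M, (X - C (k : ℝ)) ^ N with hw
  have hw0 (t : ℝ) (ht : ∀ k < M, t ≠ k) : w.eval t ≠ 0 := by
    rw [hw, eval_prod]
    refine Finset.prod_ne_zero_iff.2 fun k hk => ?_
    simpa using pow_ne_zero N (sub_ne_zero.2 (ht k (Finset.mem_range.1 hk)))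
  have hwk (k) (hk : k < M) : ∃ w' : ℝ[X], w = (X - C (k : ℝ)) ^ N * w' :=
    Finset.dvd_prod_of_mem (fun k : ℕ => (X - C (k : ℝ)) ^ N) (Finset.mem_range.2 hk)
  obtain ⟨p, hp⟩ := exists_polyPath_forall_mem (A := fun t => A ⌈t⌉₊) (fun t => hA _) 0 M
    (polyPath H) (fun t => w.eval t) (by
      intro t₀ ht₀
      by_cases hk : ∃ k < M, t₀ = k
      · obtain ⟨k, hk, rfl⟩ := hk
        obtain ⟨w', hw'⟩ := hwk k hk
        obtain ⟨c, hc, hcr⟩ := hg' k hk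
        refine ⟨0, ?_⟩
        have hcont : Continuous fun q : ℝ × E =>
            (q.1 - k) • polyPath (fun i => r i k) q.1 + w'.eval q.1 • q.2 :=
          ((continuous_fst.sub continuous_const).smul
            ((continuous_polyPath _).comp continuous_fst)).add
            ((w'.continuous.comp continuous_fst).smul continuous_snd)
        have hsmall : ∀ᶠ q : ℝ × E in 𝓝 ((k : ℝ), 0),
            ‖(q.1 - k) • polyPath (fun i => r i k) q.1 + w'.eval q.1 • q.2‖ < c :=
          hcont.norm.continuousAt.eventually (gt_mem_nhds (by simpa using hc))
        have hfst : Tendsto (fun q : ℝ × E => q.1 - k) (𝓝 ((k : ℝ), 0)) (𝓝 0) :=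
          Continuous.tendsto' (by fun_prop) _ _ (by simp)
        have hnear : ∀ᶠ q : ℝ × E in 𝓝 ((k : ℝ), 0), |q.1 - k| < 1 :=
          hfst.abs.eventually (gt_mem_nhds (by simp))
        filter_upwards [hsmall, hfst.eventually hcr, hnear] with q hq hcr hq1 hI
        have hval : polyPath H q.1 + w.eval q.1 • (0 + q.2) = polyPath (g k) (q.1 - k) +
            (q.1 - k) ^ N • ((q.1 - k) • polyPath (fun i => r i k) q.1 + w'.eval q.1 • q.2) := by
          rw [hHk k hk, hw']
          simp only [eval_mul, eval_pow, eval_sub, eval_X, eval_C]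
          module
        rw [hval]
        rw [abs_lt] at hq1
        rcases le_or_gt q.1 k with h | h
        · have : ⌈q.1⌉₊ = k := by
            rcases Nat.eq_zero_or_pos k with rfl | hk0
            · simpa using h
            · rw [Nat.ceil_eq_iff hk0.ne', Nat.cast_sub hk0]
              push_cast
              exact ⟨by linarith, h⟩
          rw [this]
          exact (hcr _ hq.le).1 (by linarith)
        · have : ⌈q.1⌉₊ = k + 1 := by
            rw [Nat.ceil_eq_iff (Nat.succ_ne_zero k)]
            push_cast
            exact ⟨by simpa using h, by linarith⟩
          rw [this]
          exact (hcr _ hq.le).2 (by linarith)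
      · push Not at hk
        obtain ⟨x, hx⟩ := hint ⌈t₀⌉₊
        have hwt := hw0 t₀ hk
        -- Off the crossing times `w` is nonzero, so the correction can move the path to the
        -- interior point `x`.
        refine ⟨(w.eval t₀)⁻¹ • (x - polyPath H t₀), ?_⟩
        have hcont : Continuous fun q : ℝ × E => polyPath H q.1 +
            w.eval q.1 • ((w.eval t₀)⁻¹ • (x - polyPath H t₀) + q.2) :=
          ((continuous_polyPath _).comp continuous_fst).add
            ((w.continuous.comp continuous_fst).smul (continuous_const.add continuous_snd))
        have hmem : ∀ᶠ q : ℝ × E in 𝓝 (t₀, 0), polyPath H q.1 +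
            w.eval q.1 • ((w.eval t₀)⁻¹ • (x - polyPath H t₀) + q.2) ∈ interior (A ⌈t₀⌉₊) := by
          refine hcont.continuousAt.eventually_mem (isOpen_interior.mem_nhds ?_)
          simpa [smul_smul, hwt] using hx
        have hfst : Tendsto (fun q : ℝ × E => q.1) (𝓝 (t₀, 0)) (𝓝 t₀) :=
          continuous_fst.tendsto _
        -- The ceiling jumps only just after an integer; the sole integer that is not a crossing
        -- time is `M`, where the interval ends.
        have hceil : ∀ᶠ q : ℝ × E in 𝓝 (t₀, 0), q.1 ∈ Icc (0 : ℝ) M → ⌈q.1⌉₊ = ⌈t₀⌉₊ := by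
          by_cases h0 : ⌈t₀⌉₊ = 0
          · have hM : M = 0 := by
              by_contra hM
              exact hk 0 (Nat.pos_of_ne_zero hM)
                (le_antisymm (by simpa using h0) ht₀.1 |>.trans (by simp))
            refine Eventually.of_forall fun q hq => ?_
            rw [h0]
            simpa [hM] using hq.2
          · have hceil_eq := (Nat.ceil_eq_iff h0).1 rfl
            rcases hceil_eq.2.eq_or_lt with heq | hlt
            · have hM : ⌈t₀⌉₊ = M := by
                refine le_antisymm (Nat.ceil_le.2 ht₀.2) (not_lt.1 fun h => hk _ h heq)
              filter_upwards [hfst.eventually (lt_mem_nhds hceil_eq.1)] with q hq hI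
              rw [Nat.ceil_eq_iff h0]
              exact ⟨hq, by rw [hM]; exact hI.2⟩
            · filter_upwards [hfst.eventually (lt_mem_nhds hceil_eq.1),
                hfst.eventually (gt_mem_nhds hlt)] with q hq hq' hI
              rw [Nat.ceil_eq_iff h0]
              exact ⟨hq, hq'.le⟩
        filter_upwards [hmem, hceil] with q hq hq' hI
        rw [hq' hI]
        exact interior_subset hq)
  have hP (t : ℝ) : polyPath (fun i => H i + w * p i) t =
      polyPath H t + w.eval t • polyPath p t := by
    ext i; simp
  refine ⟨fun i => H i + w * p i, fun t ht => by rw [hP]; exact hp t ht, fun k hk => ?_⟩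
  obtain ⟨w', hw'⟩ := hwk k hk
  rw [hP, hHk k hk, hw']
  simp [N]

end Selection

/-! ### Crossings along an analytic path -/

section Linked

variable {n : ℕ}

local notation "E" => EuclideanSpace ℝ (Fin n)

/-- There is a polynomial crossing from `A` to `B`. -/
def Linked (A B : Set E) : Prop := ∃ g N, IsCrossingOfOrder g A B N

theorem eventually_nonneg_or_neg {f m h : ℝ → ℝ} {l : Filter ℝ} {c : ℝ} (hh : Tendsto h l (𝓝 c))
    (hc : c ≠ 0) (hm : ∀ᶠ s in l, 0 < m s) (hf : ∀ᶠ s in l, f s = m s * h s) :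
    (∀ᶠ s in l, 0 ≤ f s) ∨ ∀ᶠ s in l, f s < 0 := by
  rcases hc.lt_or_gt with hc | hc
  · right
    filter_upwards [hm, hf, hh.eventually (gt_mem_nhds hc)] with s h1 h2 h3
    rw [h2]
    exact mul_neg_of_pos_of_neg h1 h3
  · left
    filter_upwards [hm, hf, hh.eventually (lt_mem_nhds hc)] with s h1 h2 h3
    rw [h2]
    exact (mul_pos h1 h3).le

/-- An analytic function of one real variable has a constant sign on either side of a point. -/
theorem eventually_nonneg_or_neg_left_right {f : ℝ → ℝ} {t₀ : ℝ}
    (hf : AnalyticAt ℝ f t₀) :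
    ((∀ᶠ s in 𝓝[<] t₀, 0 ≤ f s) ∨ ∀ᶠ s in 𝓝[<] t₀, f s < 0) ∧
      ((∀ᶠ s in 𝓝[>] t₀, 0 ≤ f s) ∨ ∀ᶠ s in 𝓝[>] t₀, f s < 0) := by
  by_cases h0 : ∀ᶠ s in 𝓝 t₀, f s = 0
  · have h : ∀ᶠ s in 𝓝 t₀, 0 ≤ f s := h0.mono fun s hs => hs.ge
    exact ⟨Or.inl (h.filter_mono nhdsWithin_le_nhds), Or.inl (h.filter_mono nhdsWithin_le_nhds)⟩
  obtain ⟨k, u, hu, hu0, hfu⟩ := hf.exists_eventuallyEq_pow_smul_nonzero_iff.2 h0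
  have hut (l : Filter ℝ) (hl : l ≤ 𝓝 t₀) : Tendsto u l (𝓝 (u t₀)) := hu.continuousAt.tendsto.mono_left hl
  constructor
  · refine eventually_nonneg_or_neg (m := fun s => (t₀ - s) ^ k) (h := fun s => (-1) ^ k * u s)
      ((hut _ nhdsWithin_le_nhds).const_mul _) (mul_ne_zero (by simp) hu0) ?_ ?_
    · filter_upwards [self_mem_nhdsWithin] with s hs
      exact pow_pos (sub_pos.2 hs) k
    · filter_upwards [hfu.filter_mono nhdsWithin_le_nhds] with s hs
      rw [hs, ← mul_assoc, ← mul_pow, smul_eq_mul]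
      ring
  · refine eventually_nonneg_or_neg (m := fun s => (s - t₀) ^ k) (hut _ nhdsWithin_le_nhds) hu0 ?_
      (hfu.filter_mono nhdsWithin_le_nhds)
    filter_upwards [self_mem_nhdsWithin] with s hs
    exact pow_pos (sub_pos.2 hs) k

variable {ι : Type*} [Finite ι]

theorem eventually_mem_or_notMem {r : ℕ} (L : Fin r → (E →ᵃ[ℝ] ℝ)) {β : ℝ → E} {l : Filter ℝ}
    (h : ∀ j, (∀ᶠ s in l, 0 ≤ L j (β s)) ∨ ∀ᶠ s in l, L j (β s) < 0) :
    (∀ᶠ s in l, β s ∈ {x | ∀ j, 0 ≤ L j x}) ∨ ∀ᶠ s in l, β s ∉ {x | ∀ j, 0 ≤ L j x} := by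
  by_cases hall : ∀ j, ∀ᶠ s in l, 0 ≤ L j (β s)
  · exact Or.inl (eventually_all.2 hall)
  · push Not at hall
    obtain ⟨j, hj⟩ := hall
    right
    have := (h j).resolve_left (by simpa [Filter.not_eventually] using hj)
    exact this.mono fun s hs hmem => not_le.2 hs (hmem j)

theorem exists_eventually_mem {K : ι → Set E} {β : ℝ → E} (hβ : ∀ t, ∃ i, β t ∈ K i)
    {l : Filter ℝ} [l.NeBot] (h : ∀ i, (∀ᶠ s in l, β s ∈ K i) ∨ ∀ᶠ s in l, β s ∉ K i) :
    ∃ i, ∀ᶠ s in l, β s ∈ K i := by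
  by_contra! hno
  have : ∀ᶠ s in l, ∀ i, β s ∉ K i := eventually_all.2 fun i => (h i).resolve_left (not_eventually.2 (hno i))
  obtain ⟨s, hs⟩ := this.exists
  obtain ⟨i, hi⟩ := hβ s
  exact hs i hi

/-- The polyhedra visited by a sufficiently generic analytic path are linked to each other. -/
theorem eqvGen_linked_of_analytic {r : ι → ℕ} (L : ∀ i, Fin (r i) → (E →ᵃ[ℝ] ℝ))
    {K : ι → Set E} (hK : ∀ i, K i = {x | ∀ j, 0 ≤ L i j x})
    {β : ℝ → E} (hβ : ∀ t, AnalyticAt ℝ β t) (hmem : ∀ t, ∃ i, β t ∈ K i)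
    {a b : ℝ} (hgen : ∀ i j, L i j ≠ 0 → L i j (β a) ≠ 0)
    {i₀ i₁ : ι} (hi₀ : β a ∈ interior (K i₀)) (hi₁ : β b ∈ interior (K i₁)) :
    Relation.EqvGen (fun i j => Linked (K i) (K j)) i₀ i₁ := by
  set R := Relation.EqvGen fun i j => Linked (K i) (K j)
  have hequiv : Equivalence R := Relation.EqvGen.is_equivalence _
  -- Identity theorem: local vanishing would propagate to the generic point `β a`.
  have hne (t : ℝ) (i) (j) (h : L i j ≠ 0) : ¬ ∀ᶠ s in 𝓝 t, L i j (β s) = 0 := fun h0 => by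
    have han : AnalyticOnNhd ℝ (fun s => L i j (β s)) univ :=
      fun s _ => analyticAt_affine_comp (L i j) (hβ s)
    exact hgen i j h (han.eqOn_zero_of_preconnected_of_eventuallyEq_zero isPreconnected_univ
      (mem_univ t) h0 (mem_univ a))
  have hleft (t : ℝ) (i) : (∀ᶠ s in 𝓝[<] t, β s ∈ K i) ∨ ∀ᶠ s in 𝓝[<] t, β s ∉ K i := by
    rw [hK]
    exact eventually_mem_or_notMem (L i) fun j =>
      (eventually_nonneg_or_neg_left_right (analyticAt_affine_comp (L i j) (hβ t))).1
  have hright (t : ℝ) (i) : (∀ᶠ s in 𝓝[>] t, β s ∈ K i) ∨ ∀ᶠ s in 𝓝[>] t, β s ∉ K i := by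
    rw [hK]
    exact eventually_mem_or_notMem (L i) fun j =>
      (eventually_nonneg_or_neg_left_right (analyticAt_affine_comp (L i j) (hβ t))).2
  have hlink (t : ℝ) (i k) (hi : ∀ᶠ s in 𝓝[<] t, β s ∈ K i) (hk : ∀ᶠ s in 𝓝[>] t, β s ∈ K k) :
      R i k := by
    refine Relation.EqvGen.rel _ _ ?_
    rw [hK] at hi hk
    rw [Linked, hK, hK]
    exact exists_isCrossingOfOrder (hβ t) (L i) (L k) (hne t i) (hne t k) hi hk
  -- The neighbourhood is punctured because at time `t` itself the path may touch a polyhedron that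
  -- it occupies on neither side.
  have hlocal (t : ℝ) : ∃ k, ∀ᶠ s in 𝓝[≠] t, ∀ m, β s ∈ K m → R k m := by
    obtain ⟨k, hk⟩ := exists_eventually_mem hmem (hleft t)
    obtain ⟨k', hk'⟩ := exists_eventually_mem hmem (hright t)
    refine ⟨k, ?_⟩
    rw [← nhdsLT_sup_nhdsGT, eventually_sup, eventually_all, eventually_all]
    refine ⟨fun m => ?_, fun m => ?_⟩
    · rcases hleft t m with h | h
      · exact Eventually.of_forall fun s _ =>
          hequiv.trans (hlink t k k' hk hk') (hequiv.symm (hlink t m k' h hk'))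
      · exact h.mono fun s hs hs' => absurd hs' hs
    · rcases hright t m with h | h
      · exact Eventually.of_forall fun s _ => hlink t k m hk h
      · exact h.mono fun s hs hs' => absurd hs' hs
  obtain ⟨k, k', hkk', hk, hk'⟩ := isPreconnected_univ.induction₂
    (fun t t' : ℝ => ∃ k k', R k k' ∧ (∀ᶠ s in 𝓝[≠] t, ∀ m, β s ∈ K m → R k m) ∧
      ∀ᶠ s in 𝓝[≠] t', ∀ m, β s ∈ K m → R k' m) (by
      intro x _
      obtain ⟨k, hk⟩ := hlocal x
      rw [nhdsWithin_univ]
      filter_upwards [(eventually_nhdsWithin_iff.1 hk).eventually_nhds] with y hy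
      refine ⟨k, k, hequiv.refl k, hk, ?_⟩
      by_cases hyx : y = x
      · rwa [hyx]
      · filter_upwards [hy.filter_mono nhdsWithin_le_nhds,
          (eventually_ne_nhds hyx).filter_mono nhdsWithin_le_nhds] with s hs hsx
        exact hs hsx) (by
      rintro x y z - - - ⟨k, k', h, hx, hy⟩ ⟨l, l', h', hy', hz⟩
      refine ⟨k, l', ?_, hx, hz⟩
      obtain ⟨s, hs, hs'⟩ := (hy.and hy').exists
      obtain ⟨m, hm⟩ := hmem s
      exact hequiv.trans h (hequiv.trans (hs m hm) (hequiv.trans (hequiv.symm (hs' m hm)) h'))) (by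
      rintro x y - - ⟨k, k', h, hx, hy⟩
      exact ⟨k', k, hequiv.symm h, hy, hx⟩) (mem_univ a) (mem_univ b)
  have hend {t : ℝ} {i k : ι} (hi : β t ∈ interior (K i))
      (hk : ∀ᶠ s in 𝓝[≠] t, ∀ m, β s ∈ K m → R k m) : R k i := by
    have hev : ∀ᶠ s in 𝓝[≠] t, β s ∈ interior (K i) :=
      ((hβ t).continuousAt.eventually_mem (isOpen_interior.mem_nhds hi)).filter_mono
        nhdsWithin_le_nhds
    obtain ⟨s, hs, hs'⟩ := (hk.and hev).exists
    exact hs i (interior_subset hs')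
  exact hequiv.trans (hequiv.symm (hend hi₀ hk)) (hequiv.trans hkk' (hend hi₁ hk'))

theorem eqvGen_linked {K : ι → Set E} (hK : ∀ i, IsFullDimCompactConvexPolyhedron (K i))
    (hint : ∀ i, (interior (K i)).Nonempty) (hS : ConnectedByAnalyticPaths (⋃ i, K i)) (i₀ i₁ : ι) :
    Relation.EqvGen (fun i j => Linked (K i) (K j)) i₀ i₁ := by
  choose r L hL using fun i => (hK i).isConvexPolyhedron
  obtain ⟨p, hp, hgen⟩ := exists_mem_forall_ne_zero (fun q : Σ i, Fin (r i) => L q.1 q.2)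
    isOpen_interior (hint i₀)
  obtain ⟨p', hp'⟩ := hint i₁
  obtain ⟨α, hα, hαS, hα0, hα1⟩ := hS p (mem_iUnion.2 ⟨i₀, interior_subset hp⟩) p'
    (mem_iUnion.2 ⟨i₁, interior_subset hp'⟩)
  -- Reparametrizing by `sin ^ 2` gives a path analytic on all of `ℝ` that never leaves the union.
  have hsin (u : ℝ) : Real.sin u ^ 2 ∈ Icc (0 : ℝ) 1 := ⟨sq_nonneg _, Real.sin_sq_le_one u⟩
  refine eqvGen_linked_of_analytic L hL (β := fun u => α (Real.sin u ^ 2)) (a := 0)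
    (b := Real.pi / 2) (fun u => ?_) (fun u => mem_iUnion.1 (hαS (hsin u))) ?_ ?_ ?_
  · exact AnalyticAt.fun_comp (g := α) (f := fun u => Real.sin u ^ 2) (hα _ (hsin u))
      (Real.analyticAt_sin.fun_pow 2)
  · intro i j h
    simpa [hα0] using hgen ⟨i, j⟩ h
  · simpa [hα0] using hp
  · simpa [hα1] using hp'

end Linked

/-! ### Families of polynomial paths visiting all the simplices -/

section Walk

variable {n : ℕ} {ι J : Type*}

local notation "E" => EuclideanSpace ℝ (Fin n)

/-- There is a finite chain of families of crossings which starts in `K i` and visits every family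
of points in `T`. -/
def HasWalk (K : ι → Set E) (i : ι) (T : Set (J → E)) : Prop :=
  ∃ (M : ℕ) (κ : ℕ → ι) (g : ℕ → J → Fin n → ℝ[X]), κ 0 = i ∧
    (∀ k < M, ∀ j, ∃ N, IsCrossingOfOrder (g k j) (K (κ k)) (K (κ (k + 1))) N) ∧
    ∀ v ∈ T, ∃ k < M, ∀ j, polyPath (g k j) 0 = v j

theorem HasWalk.cons {K : ι → Set E} {i i' : ι} {T : Set (J → E)} (h : HasWalk K i T)
    {g₀ : J → Fin n → ℝ[X]} (hg₀ : ∀ j, ∃ N, IsCrossingOfOrder (g₀ j) (K i') (K i) N) :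
    HasWalk K i' (insert (fun j => polyPath (g₀ j) 0) T) := by
  obtain ⟨M, κ, g, rfl, hg, hT⟩ := h
  refine ⟨M + 1, fun k => Nat.casesOn k i' κ, fun k => Nat.casesOn k g₀ g, rfl, ?_, ?_⟩
  · rintro (_ | k) hk
    · exact hg₀
    · exact hg k (Nat.lt_of_succ_lt_succ hk)
  · rintro v (rfl | hv)
    · exact ⟨0, Nat.succ_pos M, fun j => rfl⟩
    · obtain ⟨k, hk, hkv⟩ := hT v hv
      exact ⟨k + 1, Nat.succ_lt_succ hk, hkv⟩

theorem HasWalk.mono {K : ι → Set E} {i : ι} {T T' : Set (J → E)} (h : HasWalk K i T)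
    (hT : T' ⊆ T) : HasWalk K i T' := by
  obtain ⟨M, κ, g, h0, hg, hv⟩ := h
  exact ⟨M, κ, g, h0, hg, fun v hv' => hv v (hT hv')⟩

/-- Crossings are reversible and can be prepended to a walk, using the same crossing for every
member of the family. -/
theorem hasWalk_iff_of_eqvGen {K : ι → Set E} {i i' : ι} (T : Set (J → E))
    (h : Relation.EqvGen (fun i j => Linked (K i) (K j)) i i') : HasWalk K i T ↔ HasWalk K i' T := by
  induction h with
  | rel i i' h =>
    obtain ⟨g, N, hg⟩ := h
    exact ⟨fun hw => (hw.cons (g₀ := fun _ => _) fun _ => ⟨N, hg.symm⟩).mono (subset_insert _ _),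
      fun hw => (hw.cons (g₀ := fun _ => g) fun _ => ⟨N, hg⟩).mono (subset_insert _ _)⟩
  | refl => rfl
  | symm _ _ _ ih => exact ih.symm
  | trans _ _ _ _ _ ih ih' => exact ih.trans ih'

theorem hasWalk_of_finite {K : ι → Set E} (hK : ∀ i, Convex ℝ (K i))
    (hint : ∀ i, (interior (K i)).Nonempty)
    (hlink : ∀ i j, Relation.EqvGen (fun i j => Linked (K i) (K j)) i j)
    {T : Set (J → E)} (hT : T.Finite) (hTK : ∀ v ∈ T, ∃ i, ∀ j, v j ∈ K i) (i : ι) :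
    HasWalk K i T := by
  induction T, hT using Set.Finite.induction_on with
  | empty => exact ⟨0, fun _ => i, fun _ _ _ => 0, rfl, by simp, by simp⟩
  | @insert v T _ _ ih =>
    obtain ⟨i', hi'⟩ := hTK v (mem_insert _ _)
    have hw := ih fun v hv => hTK v (mem_insert_of_mem _ hv)
    rw [hasWalk_iff_of_eqvGen T (hlink i i')] at hw
    -- Having reached a body containing the family, each path touches its own point while all remain
    -- in `K i'`.
    choose g hg0 hg using fun j => exists_isCrossingOfOrder_self (hK i') (hint i') (hi' j)
    have := hw.cons fun j => ⟨2, hg j⟩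
    simp only [hg0] at this
    exact (hasWalk_iff_of_eqvGen _ (hlink i i')).2 this

/-- A finite union of linked convex bodies contains polynomial families of simplices which visit
any given finite set of simplices. -/
theorem exists_polyPath_family {K : ι → Set E} (hK : ∀ i, Convex ℝ (K i))
    (hint : ∀ i, (interior (K i)).Nonempty)
    (hlink : ∀ i j, Relation.EqvGen (fun i j => Linked (K i) (K j)) i j) [Nonempty ι]
    {T : Set (J → E)} (hT : T.Finite) (hTK : ∀ v ∈ T, ∃ i, ∀ j, v j ∈ K i) :
    ∃ (M : ℕ) (P : J → Fin n → ℝ[X]),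
      (∀ t ∈ Icc (0 : ℝ) M, ∃ i, ∀ j, polyPath (P j) t ∈ K i) ∧
      ∀ v ∈ T, ∃ t ∈ Icc (0 : ℝ) 1, ∀ j, polyPath (P j) (M * t) = v j := by
  obtain ⟨M, κ, g, -, hg, hv⟩ :=
    hasWalk_of_finite hK hint hlink hT hTK (Classical.arbitrary ι)
  choose! N hN using hg
  -- The chain `κ` does not depend on `j`, so at each time all the paths share one body.
  choose P hP hPk using fun j => exists_polyPath_chain (fun k => K (κ k)) (fun k => hK _)
    (fun k => hint _) M (fun k => g k j) (fun k => N k j) fun k hk => hN k hk j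
  refine ⟨M, P, fun t ht => ⟨_, fun j => hP j t ht⟩, fun v hvT => ?_⟩
  obtain ⟨k, hk, hkv⟩ := hv v hvT
  have hM : (0 : ℝ) < M := by exact_mod_cast (Nat.zero_le k).trans_lt hk
  refine ⟨k / M, ⟨by positivity, (div_le_one hM).2 (by exact_mod_cast hk.le)⟩, fun j => ?_⟩
  rw [mul_div_cancel₀ _ hM.ne', hPk j k hk, hkv]

end Walk

/-! ### The prism as a polynomial image of the ball -/

section Ball

variable {n : ℕ}

local notation "E" => EuclideanSpace ℝ (Fin n)

/-- Since `[0, 1/2]` already suffices, time and weights can each use half of the squared radius, so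
every pair is attained in the unit ball. -/
theorem exists_four_mul_self_mul_one_sub {t : ℝ} (ht : t ∈ Icc (0 : ℝ) 1) :
    ∃ y ∈ Icc (0 : ℝ) (1 / 2), 4 * y * (1 - y) = t := by
  have h1 : 0 ≤ 1 - t := by linarith [ht.2]
  have h2 : √(1 - t) ≤ 1 := Real.sqrt_le_one.2 (by linarith [ht.1])
  refine ⟨(1 - √(1 - t)) / 2, ⟨by linarith, by linarith [Real.sqrt_nonneg (1 - t)]⟩, ?_⟩
  linarith [Real.sq_sqrt h1]

/-- The polynomial weights of the simplex on the ball. -/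
noncomputable def ballWeight (u : ℝ) (y : Fin n → ℝ) : Fin (n + 1) → ℝ :=
  Fin.cons ((1 - 2 * u) ^ 2) fun i => 4 * y i ^ 2 * (1 - u)

theorem ballWeight_nonneg {u : ℝ} (hu : u ≤ 1) (y : Fin n → ℝ) (j : Fin (n + 1)) :
    0 ≤ ballWeight u y j := by
  refine Fin.cases ?_ (fun i => ?_) j
  · exact sq_nonneg _
  · have : 0 ≤ 1 - u := by linarith
    simp only [ballWeight, Fin.cons_succ]
    positivity

/-- This is the identity `(1 - 2u) ^ 2 + 4u(1 - u) = 1`. -/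
theorem sum_ballWeight (y : Fin n → ℝ) : ∑ j, ballWeight (∑ i, y i ^ 2) y j = 1 := by
  simp only [ballWeight, Fin.sum_univ_succ, Fin.cons_zero, Fin.cons_succ]
  rw [← Finset.sum_mul, ← Finset.mul_sum]
  ring

theorem exists_ballWeight_eq {w : Fin (n + 1) → ℝ} (hw : ∀ j, 0 ≤ w j) (hw1 : ∑ j, w j = 1) :
    ∃ y : Fin n → ℝ, ∑ i, y i ^ 2 ≤ 1 / 2 ∧ ballWeight (∑ i, y i ^ 2) y = w := by
  rw [Fin.sum_univ_succ] at hw1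
  have hσ : 0 ≤ ∑ i : Fin n, w i.succ := Finset.sum_nonneg fun i _ => hw _
  -- The squared norm `u` must satisfy `4u(1 - u) = 1 - w 0`; the coordinates are then square roots
  -- of rescaled weights.
  obtain ⟨u, ⟨hu0, hu1⟩, hu⟩ := exists_four_mul_self_mul_one_sub
    (t := ∑ i : Fin n, w i.succ) ⟨hσ, by linarith [hw 0]⟩
  have hpos : 0 < 4 * (1 - u) := by linarith
  have hy (i : Fin n) : √(w i.succ / (4 * (1 - u))) ^ 2 = w i.succ / (4 * (1 - u)) :=
    Real.sq_sqrt (div_nonneg (hw _) hpos.le)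
  have hsum : ∑ i : Fin n, √(w i.succ / (4 * (1 - u))) ^ 2 = u := by
    simp only [hy]
    rw [← Finset.sum_div, ← hu, div_eq_iff hpos.ne']
    ring
  refine ⟨fun i => √(w i.succ / (4 * (1 - u))), by rw [hsum]; exact hu1, ?_⟩
  rw [hsum]
  funext j
  refine Fin.cases ?_ (fun i => ?_) j
  · simp only [ballWeight, Fin.cons_zero]
    linarith
  · simp only [ballWeight, Fin.cons_succ, hy]
    have : 1 - u ≠ 0 := by linarith
    field_simp

theorem norm_le_one_iff (x : EuclideanSpace ℝ (Fin (n + 1))) :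
    ‖x‖ ≤ 1 ↔ x 0 ^ 2 + ∑ i : Fin n, x i.succ ^ 2 ≤ 1 := by
  rw [← sq_le_one_iff₀ (norm_nonneg x), EuclideanSpace.real_norm_sq_eq, Fin.sum_univ_succ]

/-- The union of a polynomial family of simplices is a polynomial image of the ball. -/
theorem exists_isPolynomialMap_image_eq (M : ℕ) (P : Fin (n + 1) → Fin n → ℝ[X]) :
    ∃ f : EuclideanSpace ℝ (Fin (n + 1)) → E, IsPolynomialMap f ∧
      f '' Metric.closedBall 0 1 = {x | ∃ t ∈ Icc (0 : ℝ) 1, ∃ w : Fin (n + 1) → ℝ,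
        (∀ j, 0 ≤ w j) ∧ ∑ j, w j = 1 ∧ ∑ j, w j • polyPath (P j) (M * t) = x} := by
  set τ : MvPolynomial (Fin (n + 1)) ℝ :=
    MvPolynomial.C (M : ℝ) * (4 * MvPolynomial.X 0 ^ 2 * (1 - MvPolynomial.X 0 ^ 2)) with hτ
  set u : MvPolynomial (Fin (n + 1)) ℝ := ∑ i : Fin n, MvPolynomial.X i.succ ^ 2 with hu
  set b : Fin (n + 1) → MvPolynomial (Fin (n + 1)) ℝ :=
    Fin.cons ((1 - 2 * u) ^ 2) fun i => 4 * MvPolynomial.X i.succ ^ 2 * (1 - u) with hb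
  set p : Fin n → MvPolynomial (Fin (n + 1)) ℝ := fun i => ∑ j, b j * aeval τ (P j i) with hp
  set f : EuclideanSpace ℝ (Fin (n + 1)) → E :=
    fun x => WithLp.toLp 2 fun i => MvPolynomial.eval (fun j => x j) (p i) with hf
  have hval (x : EuclideanSpace ℝ (Fin (n + 1))) :
      f x = ∑ j, ballWeight (∑ i : Fin n, x i.succ ^ 2) (fun i => x i.succ) j •
        polyPath (P j) (M * (4 * x 0 ^ 2 * (1 - x 0 ^ 2))) := by
    have hb' (j) : MvPolynomial.eval (fun j => x j) (b j) =
        ballWeight (∑ i : Fin n, x i.succ ^ 2) (fun i => x i.succ) j := by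
      refine Fin.cases ?_ (fun i => ?_) j <;> simp [hb, hu, ballWeight]
    have hτ' : MvPolynomial.eval (fun j => x j) τ = M * (4 * x 0 ^ 2 * (1 - x 0 ^ 2)) := by
      simp [hτ]
    have hP (q : ℝ[X]) : MvPolynomial.eval (fun j => x j) (aeval τ q) =
        q.eval (M * (4 * x 0 ^ 2 * (1 - x 0 ^ 2))) := by
      rw [← hτ', ← MvPolynomial.coe_aeval_eq_eval, ← Polynomial.coe_aeval_eq_eval]
      exact (Polynomial.aeval_algHom_apply (MvPolynomial.aeval fun j => x j) τ q).symm
    ext i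
    simp [hf, hp, hb', hP]
  refine ⟨f, ⟨p, fun x i => rfl⟩, Set.ext fun z => ⟨?_, ?_⟩⟩
  · rintro ⟨x, hx, rfl⟩
    rw [mem_closedBall_zero_iff, norm_le_one_iff] at hx
    have h0 : 0 ≤ ∑ i : Fin n, x i.succ ^ 2 := Finset.sum_nonneg fun i _ => sq_nonneg _
    have hx0 : 0 ≤ 1 - x 0 ^ 2 := by linarith
    exact ⟨_, ⟨by positivity, by nlinarith [sq_nonneg (1 - 2 * x 0 ^ 2)]⟩, _,
      ballWeight_nonneg (by linarith [sq_nonneg (x 0)]) _, sum_ballWeight _, (hval x).symm⟩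
  · rintro ⟨t, ht, w, hw, hw1, rfl⟩
    obtain ⟨y, hy, rfl⟩ := exists_ballWeight_eq hw hw1
    obtain ⟨a, ha, rfl⟩ := exists_four_mul_self_mul_one_sub ht
    have hsq : √a ^ 2 = a := Real.sq_sqrt ha.1
    -- Both `a` and `∑ i, y i ^ 2` are at most `1 / 2`.
    refine ⟨WithLp.toLp 2 (Fin.cons (√a) y : Fin (n + 1) → ℝ), ?_, ?_⟩
    · rw [mem_closedBall_zero_iff, norm_le_one_iff]
      simp only [Fin.cons_zero, Fin.cons_succ, hsq]
      linarith [ha.2]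
    · rw [hval]
      simp only [Fin.cons_zero, Fin.cons_succ, hsq]

theorem connectedByAnalyticPaths_image {m : ℕ} {f : EuclideanSpace ℝ (Fin m) → E}
    (hf : IsPolynomialMap f) {s : Set (EuclideanSpace ℝ (Fin m))} (hs : Convex ℝ s) :
    ConnectedByAnalyticPaths (f '' s) := by
  rintro _ ⟨x, hx, rfl⟩ _ ⟨y, hy, rfl⟩
  obtain ⟨p, hp⟩ := hf
  refine ⟨fun t => f (AffineMap.lineMap x y t), fun t _ => ?_, fun t ht => ?_, by simp, by simp⟩
  · have hcoord (j : Fin m) : AnalyticAt ℝ (fun t : ℝ => AffineMap.lineMap x y t j) t := by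
      simp only [AffineMap.lineMap_apply, vsub_eq_sub, vadd_eq_add, PiLp.add_apply, PiLp.smul_apply,
        PiLp.sub_apply, smul_eq_mul]
      fun_prop
    have hpi : AnalyticAt ℝ (fun (t : ℝ) i => f (AffineMap.lineMap x y t) i) t := by
      refine analyticAt_pi_iff.2 fun i => ?_
      simp only [hp, ← MvPolynomial.coe_aeval_eq_eval]
      exact AnalyticAt.aeval_mvPolynomial hcoord (p i)
    exact ((EuclideanSpace.equiv (Fin n) ℝ).symm.toContinuousLinearMap.analyticAt _).comp hpi
  · exact ⟨_, hs.lineMap_mem hx hy ht, rfl⟩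

end Ball

end PolynomialBallImage

theorem mainTheorem1 (n : ℕ) {ι : Type*} [Finite ι] [Nonempty ι]
    (K : ι → Set (EuclideanSpace ℝ (Fin n)))
    (hK : ∀ i, IsFullDimCompactConvexPolyhedron (K i))
    (S : Set (EuclideanSpace ℝ (Fin n))) (hS : S = ⋃ i, K i) :
    ConnectedByAnalyticPaths S ↔
      ∃ f : EuclideanSpace ℝ (Fin (n + 1)) → EuclideanSpace ℝ (Fin n),
        IsPolynomialMap f ∧ f '' Metric.closedBall 0 1 = S := by
  constructor
  swap
  · rintro ⟨f, hf, rfl⟩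
    exact PolynomialBallImage.connectedByAnalyticPaths_image hf (convex_closedBall _ _)
  intro hconn
  subst hS
  have hconv (i) : Convex ℝ (K i) := by
    obtain ⟨r, L, hL⟩ := (hK i).isConvexPolyhedron
    rw [hL]
    exact PolynomialBallImage.convex_setOf_forall_nonneg L
  have hint (i) : (interior (K i)).Nonempty :=
    (hconv i).interior_nonempty_iff_affineSpan_eq_top.2 (hK i).affineSpan_eq_top
  choose T hTfin hTK hTcov using fun i =>
    PolynomialBallImage.exists_finite_simplices (hK i).isConvexPolyhedron (hK i).isCompact
  obtain ⟨M, P, hP, hPT⟩ := PolynomialBallImage.exists_polyPath_family hconv hint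
    (PolynomialBallImage.eqvGen_linked hK hint hconn) (finite_iUnion hTfin)
    (fun v hv => (mem_iUnion.1 hv).imp fun i hi => hTK i v hi)
  obtain ⟨f, hf, hfim⟩ := PolynomialBallImage.exists_isPolynomialMap_image_eq M P
  refine ⟨f, hf, hfim.trans (Subset.antisymm ?_ ?_)⟩
  · rintro _ ⟨t, ht, w, hw, hw1, rfl⟩
    obtain ⟨i, hi⟩ := hP (M * t) ⟨mul_nonneg (Nat.cast_nonneg M) ht.1,
      mul_le_of_le_one_right (Nat.cast_nonneg M) ht.2⟩
    exact mem_iUnion.2 ⟨i, (hconv i).sum_mem (fun j _ => hw j) hw1 fun j _ => hi j⟩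
  · intro x hx
    obtain ⟨i, hi⟩ := mem_iUnion.1 hx
    obtain ⟨v, hv, w, hw, hw1, hwx⟩ := hTcov i x hi
    obtain ⟨t, ht, htv⟩ := hPT v (mem_iUnion.2 ⟨i, hv⟩)
    exact ⟨t, ht, w, hw, hw1, by simpa only [htv] using hwx⟩
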